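/- Let $\mathrm R$ be the category with two objects $\mathbf 1,\mathbf N$, where $\mathbf 1$ is terminal, $\mathrm R(\mathbf 1,\mathbf N)=\mathbb N$ and $\mathrm R(\mathbf N,\mathbf N)$ is the set of primitive recursive functions $\mathbb N\to\mathbb N$. Let $\mathrm J_{\mathrm{fin}}$ be the Grothendieck topology on $\mathrm R$ generated by the finite jointly surjective families, let $\mathcal R=\mathrm{Sh}(\mathrm R,\mathrm J_{\mathrm{fin}})$, and let $y_{\mathbf N}\in\mathcal R$ be the sheaf associated with the presheaf represented by $\mathbf N$, with its zero $0$ and successor map $\mathsf s$. Let $\mathcal U_0$ be a universe in $\mathcal R$, given by its generic family $\tau:\mathcal E\to\mathcal U_0$; no property of $\tau$ is needed, so $\tau$ may be any morphism of $\mathcal R$, and a type $X:\mathcal U_0$ is a fibre of $\tau$. Working in the internal language of $\mathcal R$, define $$\hat{\mathcal U}_0^{\mathrm{pr}}:=(X:\mathcal U_0)\times(r:y_{\mathbf N}\to X+1)\times(s:X+1\to y_{\mathbf N})\times(r\circ s=\mathrm{id}_{X+1}),$$ the object of types $X$ such that $X+1$ is equipped with the structure of a retract of $y_{\mathbf N}$,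 and $$\mathcal U_0^{\mathrm{pr}}:=(X:\mathcal U_0)\times\Bigl((g:X)\to(h:y_{\mathbf N}\to X\to X)\to\bigl((f:y_{\mathbf N}\to X)\times(f(0)=g)\times((n:y_{\mathbf N})\to f(\mathsf s\,n)=h(n,f(n)))\bigr)\Bigr),$$ the object of types equipped with (non-dependent) $y_{\mathbf N}$-recursion. Then there is a morphism $\Phi:\hat{\mathcal U}_0^{\mathrm{pr}}\to\mathcal U_0^{\mathrm{pr}}$ in $\mathcal R$ that preserves underlying types, i.e. that commutes with the two projections to $\mathcal U_0$. -/

import Mathlib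

universe u

open CategoryTheory Opposite

/-! ### The site of primitive recursive functions -/

/-- The two objects `𝟏` and `𝐍` of the category of arities. -/
inductive Arity : Type
  | one
  | nat

namespace Arity

/-- The set of points of an object: `𝟏` has one point, `𝐍` has the natural numbers. -/
def Pt : Arity → Type
  | one => Unit
  | nat => ℕ

instance : ∀ a : Arity, Primcodable a.Pt
  | one => inferInstanceAs (Primcodable Unit)
  | nat => inferInstanceAs (Primcodable ℕ)

instance : ∀ a : Arity, Inhabited a.Pt
  | one => ⟨()⟩
  | nat => ⟨(0 : ℕ)⟩

/-- Morphisms are the primitive recursive functions between the sets of points. So morphisms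
`𝐍 ⟶ 𝐍` are the primitive recursive functions `ℕ → ℕ`, morphisms `𝟏 ⟶ 𝐍` are the natural numbers
(every function `Unit → ℕ` is primitive recursive), and `𝟏` is terminal. -/
instance : SmallCategory Arity where
  Hom a b := { f : a.Pt → b.Pt // Primrec f }
  id _ := ⟨id, Primrec.id⟩
  comp f g := ⟨g.1 ∘ f.1, g.2.comp f.2⟩

/-- The morphism `𝟏 ⟶ 𝐍`, or the constant morphism `a ⟶ 𝐍`, with value `0`. -/
def zeroHom (a : Arity) : a ⟶ nat := ⟨fun _ => (0 : ℕ), Primrec.const (0 : ℕ)⟩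

/-- The successor function as an endomorphism of `𝐍`. -/
def succHom : nat ⟶ nat := ⟨Nat.succ, Primrec.succ⟩

/-- A sieve is covering if it contains a finite jointly surjective family. -/
def IsFinCover {a : Arity} (S : Sieve a) : Prop :=
  ∃ T : Set (Σ b : Arity, b ⟶ a), T.Finite ∧ (∀ t ∈ T, S t.2) ∧
    ∀ y : a.Pt, ∃ t ∈ T, ∃ x : t.1.Pt, t.2.1 x = y

/-- For a morphism `f : b ⟶ a` and a morphism `g : c ⟶ a`, the points of `c` whose image under `g`
lies in the image of `f` are enumerated by a morphism `h` such that `h ≫ g` factors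
through `f`, provided there is at least one such point. -/
theorem exists_enum {a b c : Arity} (f : b ⟶ a) (g : c ⟶ a) (x₀ : b.Pt) (y₀ : c.Pt)
    (h₀ : f.1 x₀ = g.1 y₀) :
    ∃ (h : nat ⟶ c) (k : nat ⟶ b), h ≫ g = k ≫ f ∧
      ∀ (x : b.Pt) (y : c.Pt), f.1 x = g.1 y → ∃ n, h.1 n = y := by
  classical
  let D : ℕ → b.Pt × c.Pt := fun n => (Encodable.decode (α := b.Pt × c.Pt) n).getD (x₀, y₀)
  have hD : Primrec D := Primrec.option_getD.comp Primrec.decode (Primrec.const _)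
  let e : ℕ → b.Pt × c.Pt := fun n => if f.1 (D n).1 = g.1 (D n).2 then D n else (x₀, y₀)
  have he : Primrec e := Primrec.ite
    (Primrec.eq.comp (f.2.comp (Primrec.fst.comp hD)) (g.2.comp (Primrec.snd.comp hD)))
    hD (Primrec.const _)
  have hfe : ∀ n, f.1 (e n).1 = g.1 (e n).2 := by
    intro n
    by_cases hn : f.1 (D n).1 = g.1 (D n).2
    · simp only [e, if_pos hn, hn]
    · simp only [e, if_neg hn, h₀]
  refine ⟨⟨fun n => (e n).2, Primrec.snd.comp he⟩, ⟨fun n => (e n).1, Primrec.fst.comp he⟩,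
    Subtype.ext (funext fun n => (hfe n).symm), fun x y hxy => ?_⟩
  refine ⟨(Encodable.encode (x, y) : ℕ), ?_⟩
  have h1 : D (Encodable.encode (x, y)) = (x, y) := by simp [D]
  have h2 : e (Encodable.encode (x, y)) = (x, y) := by simp only [e, h1, if_pos hxy]
  exact congrArg Prod.snd h2

/-- The Grothendieck topology generated by the finite jointly surjective families. -/
def finTopology : GrothendieckTopology Arity where
  sieves a := { S | IsFinCover S }
  top_mem' a := ⟨{⟨a, 𝟙 a⟩}, Set.finite_singleton _, fun _ _ => trivial,
    fun y => ⟨_, rfl, y, rfl⟩⟩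
  pullback_stable' := by
    rintro a c S g ⟨T, hT, hTS, hs⟩
    classical
    let P : (Σ b : Arity, b ⟶ a) → Prop := fun t => ∃ (x : t.1.Pt) (y : c.Pt), t.2.1 x = g.1 y
    have key : ∀ t : Σ b : Arity, b ⟶ a, ∃ h : nat ⟶ c, P t →
        (∃ k : nat ⟶ t.1, h ≫ g = k ≫ t.2) ∧
          ∀ (x : t.1.Pt) (y : c.Pt), t.2.1 x = g.1 y → ∃ n, h.1 n = y := by
      intro t
      by_cases ht : P t
      · obtain ⟨x, y, hxy⟩ := ht
        obtain ⟨h, k, hk, hh⟩ := exists_enum t.2 g x y hxy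
        exact ⟨h, fun _ => ⟨⟨k, hk⟩, hh⟩⟩
      · exact ⟨⟨fun _ => default, Primrec.const _⟩, fun h => absurd h ht⟩
    choose h hh using key
    refine ⟨(fun t => (⟨nat, h t⟩ : Σ b : Arity, b ⟶ c)) '' {t ∈ T | P t},
      (hT.subset (Set.sep_subset _ _)).image _, ?_, fun y => ?_⟩
    · rintro _ ⟨t, ⟨ht, hP⟩, rfl⟩
      obtain ⟨k, hk⟩ := (hh t hP).1
      change S (h t ≫ g)
      rw [hk]
      exact S.downward_closed (hTS t ht) k
    · obtain ⟨t, ht, x, hx⟩ := hs (g.1 y)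
      have hP : P t := ⟨x, y, hx⟩
      obtain ⟨n, hn⟩ := (hh t hP).2 x y hx
      exact ⟨_, ⟨t, ⟨ht, hP⟩, rfl⟩, n, hn⟩
  transitive' := by
    rintro a S ⟨T, hT, hTS, hs⟩ R hR
    have hR' : ∀ t : T, IsFinCover (R.pullback t.1.2) := fun t => hR (hTS t.1 t.2)
    choose T' hT' hTR hs' using hR'
    have := hT.to_subtype
    refine ⟨⋃ t : T, (fun r : Σ b : Arity, b ⟶ t.1.1 =>
        (⟨r.1, r.2 ≫ t.1.2⟩ : Σ b : Arity, b ⟶ a)) '' T' t,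
      Set.finite_iUnion fun t => (hT' t).image _, ?_, fun y => ?_⟩
    · intro r hr
      obtain ⟨t, q, hq, rfl⟩ := Set.mem_iUnion.1 hr
      exact hTR t q hq
    · obtain ⟨t, ht, x, hx⟩ := hs y
      obtain ⟨q, hq, z, hz⟩ := hs' ⟨t, ht⟩ x
      refine ⟨_, Set.mem_iUnion.2 ⟨⟨t, ht⟩, q, hq, rfl⟩, z, ?_⟩
      change t.2.1 (q.2.1 z) = y
      rw [hz, hx]

/-- The topos `𝓡` of sheaves on the site of primitive recursive functions. -/
abbrev Topos : Type (u + 1) := Sheaf finTopology (Type u)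

instance : Limits.HasBinaryCoproducts Topos.{u} :=
  have : HasSheafify finTopology (Type u) := inferInstance
  have : Limits.HasColimitsOfShape (Discrete Limits.WalkingPair) (Type u) :=
    Limits.Types.hasColimitsOfShape
  Sheaf.instHasColimitsOfShape

/-- The sheaf `y_𝐍`: the sheafification of the presheaf represented by `𝐍`. -/
noncomputable def yN : Topos.{u} :=
  (presheafToSheaf finTopology (Type u)).obj (uliftYoneda.{u}.obj nat)

/-- The element `0` of `y_𝐍` at each stage. -/
noncomputable def yzero (c : Arityᵒᵖ) : yN.{u}.obj.obj c :=
  (toSheafify finTopology (uliftYoneda.{u}.obj nat)).app c (ULift.up (zeroHom c.unop))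

theorem map_yzero {c d : Arityᵒᵖ} (φ : c ⟶ d) : yN.{u}.obj.map φ (yzero c) = yzero d :=
  (NatTrans.naturality_apply (toSheafify finTopology (uliftYoneda.{u}.obj nat)) φ _).symm

/-- The successor map of `y_𝐍`. -/
noncomputable def ysucc : yN.{u} ⟶ yN.{u} :=
  (presheafToSheaf finTopology (Type u)).map (uliftYoneda.{u}.map succHom)

end Arity

/-! ### Types in context

A type depending on a parameter in a presheaf `B` is a map `p : A ⟶ B`; the fibre of `p` over
`x : B c` at a later stage `φ : c ⟶ d` consists of the `a : A d` with `p a = B φ x`. -/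

section Slice

variable {C : Type} [SmallCategory C] {A B D : Cᵒᵖ ⥤ Type u}

/-- The type `{(a, b) | p a = q b}`, which is the product in the slice over `B`. -/
def fiberProd (p : A ⟶ B) (q : D ⟶ B) : Cᵒᵖ ⥤ Type u where
  obj c := { t : A.obj c × D.obj c // p.app c t.1 = q.app c t.2 }
  map {c d} φ := ↾fun t => ⟨(A.map φ t.1.1, D.map φ t.1.2), by
    simp only [NatTrans.naturality_apply, t.2]⟩

/-- The projection of the product in the slice to the base. -/
def fiberProdBase (p : A ⟶ B) (q : D ⟶ B) : fiberProd p q ⟶ B where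
  app c := ↾fun t => p.app c t.1.1
  naturality _ _ φ := by
    ext t
    exact NatTrans.naturality_apply p φ t.1.1

/-- An element, at stage `c` and over `x : B c`, of the function type from `p : A ⟶ B` to
`q : D ⟶ B`: a function between the fibres over `x`, given at all later stages and natural. -/
@[ext]
structure FunAt (p : A ⟶ B) (q : D ⟶ B) {c : Cᵒᵖ} (x : B.obj c) where
  /-- The value at an element of the fibre at a later stage. -/
  toFun : ∀ ⦃d : Cᵒᵖ⦄ (φ : c ⟶ d) (a : A.obj d), p.app d a = B.map φ x → D.obj d
  base_toFun : ∀ ⦃d : Cᵒᵖ⦄ (φ : c ⟶ d) (a : A.obj d) (ha : p.app d a = B.map φ x),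
    q.app d (toFun φ a ha) = B.map φ x
  map_toFun : ∀ ⦃d e : Cᵒᵖ⦄ (φ : c ⟶ d) (ψ : d ⟶ e) (a : A.obj d)
    (ha : p.app d a = B.map φ x),
    D.map ψ (toFun φ a ha) = toFun (φ ≫ ψ) (A.map ψ a) (by
      rw [NatTrans.naturality_apply, ha, Functor.map_comp_apply])

/-- Restriction of a function to a later stage. -/
@[simps]
def FunAt.restrict {p : A ⟶ B} {q : D ⟶ B} {c c' : Cᵒᵖ} {x : B.obj c} (f : FunAt p q x)
    (χ : c ⟶ c') {x' : B.obj c'} (hx : B.map χ x = x') : FunAt p q x' where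
  toFun d φ a ha := f.toFun (χ ≫ φ) a (by rw [ha, ← hx, Functor.map_comp_apply])
  base_toFun d φ a ha := by rw [f.base_toFun, ← hx, Functor.map_comp_apply]
  map_toFun d e φ ψ a ha := by
    rw [f.map_toFun]; simp only [Category.assoc]

/-- Two elements of the total space of a function type are equal if they lie over the same element
of the base and have the same values. -/
theorem FunAt.sigma_ext {p : A ⟶ B} {q : D ⟶ B} {c : Cᵒᵖ} {s t : Σ x : B.obj c, FunAt p q x}
    (h : s.1 = t.1) (h' : ∀ ⦃d : Cᵒᵖ⦄ (φ : c ⟶ d) (a : A.obj d) (hs : p.app d a = B.map φ s.1)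
      (ht : p.app d a = B.map φ t.1), s.2.toFun φ a hs = t.2.toFun φ a ht) : s = t := by
  obtain ⟨x, f⟩ := s
  obtain ⟨y, g⟩ := t
  obtain rfl : x = y := h
  congr 1
  ext d φ a ha
  exact h' φ a ha ha

theorem FunAt.congr_sigma {p : A ⟶ B} {q : D ⟶ B} {c : Cᵒᵖ} {s t : Σ x : B.obj c, FunAt p q x}
    (h : s = t) {d : Cᵒᵖ} (φ : c ⟶ d) (a : A.obj d) (hs : p.app d a = B.map φ s.1)
    (ht : p.app d a = B.map φ t.1) : s.2.toFun φ a hs = t.2.toFun φ a ht := by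
  subst h; rfl

theorem FunAt.toFun_congr {p : A ⟶ B} {q : D ⟶ B} {c : Cᵒᵖ} {x : B.obj c} (f : FunAt p q x)
    {d : Cᵒᵖ} {φ ψ : c ⟶ d} (h : φ = ψ) {a b : A.obj d} (hab : a = b)
    (ha : p.app d a = B.map φ x) (hb : p.app d b = B.map ψ x) :
    f.toFun φ a ha = f.toFun ψ b hb := by
  subst h; subst hab; rfl

/-- The function type from `p : A ⟶ B` to `q : D ⟶ B`, which is the exponential in the slice
over `B`. Its elements at stage `c` are pairs of an `x : B c` and a function between the fibres
over `x`. -/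
def sliceExp (p : A ⟶ B) (q : D ⟶ B) : Cᵒᵖ ⥤ Type u where
  obj c := Σ x : B.obj c, FunAt p q x
  map {c c'} χ := ↾fun s => ⟨B.map χ s.1, s.2.restrict χ rfl⟩
  map_id c := ConcreteCategory.hom_ext _ _ fun s =>
    FunAt.sigma_ext (s := ⟨B.map (𝟙 c) s.1, s.2.restrict (𝟙 c) rfl⟩) (t := s)
      (Functor.map_id_apply B _ _) fun d φ a _ _ => by
        change s.2.toFun (𝟙 c ≫ φ) a _ = s.2.toFun φ a _
        simp only [Category.id_comp]
  map_comp χ χ' := ConcreteCategory.hom_ext _ _ fun s =>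
    FunAt.sigma_ext (s := ⟨B.map (χ ≫ χ') s.1, s.2.restrict (χ ≫ χ') rfl⟩)
      (t := ⟨B.map χ' (B.map χ s.1), (s.2.restrict χ rfl).restrict χ' rfl⟩)
      (Functor.map_comp_apply B _ _ _) fun d φ a _ _ => by
        change s.2.toFun ((χ ≫ χ') ≫ φ) a _ = s.2.toFun (χ ≫ χ' ≫ φ) a _
        simp only [Category.assoc]

/-- The projection of a function type to the base. -/
def sliceExpBase (p : A ⟶ B) (q : D ⟶ B) : sliceExp p q ⟶ B where
  app _ := ↾fun s => s.1
  naturality _ _ _ := rfl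

variable {J : GrothendieckTopology C}

theorem isSheaf_prod (hA : Presieve.IsSheaf J A) (hD : Presieve.IsSheaf J D) :
    Presieve.IsSheaf J (FunctorToTypes.prod A D) := by
  intro c S hS
  rw [← Presieve.isSeparatedFor_and_exists_isAmalgamation_iff_isSheafFor]
  refine ⟨fun x t t' h h' => Prod.ext ?_ ?_, fun x hx => ?_⟩
  · exact (hA S hS).isSeparatedFor.ext fun d f hf =>
      congrArg Prod.fst ((h f hf).trans (h' f hf).symm)
  · exact (hD S hS).isSeparatedFor.ext fun d f hf =>
      congrArg Prod.snd ((h f hf).trans (h' f hf).symm)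
  · have h1 := hx.map (FunctorToTypes.prod.fst (F := A) (G := D))
    have h2 := hx.map (FunctorToTypes.prod.snd (F := A) (G := D))
    obtain ⟨a, ha, -⟩ := hA S hS _ h1
    obtain ⟨b, hb, -⟩ := hD S hS _ h2
    exact ⟨(a, b), fun d f hf => Prod.ext (ha f hf) (hb f hf)⟩

theorem isSheaf_fiberProd (p : A ⟶ B) (q : D ⟶ B) (hA : Presieve.IsSheaf J A)
    (hD : Presieve.IsSheaf J D) (hB : Presieve.IsSheaf J B) :
    Presieve.IsSheaf J (fiberProd p q) := by
  intro c S hS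
  rw [← Presieve.isSeparatedFor_and_exists_isAmalgamation_iff_isSheafFor]
  refine ⟨fun x t t' h h' => Subtype.ext (Prod.ext ?_ ?_), fun x hx => ?_⟩
  · exact (hA S hS).isSeparatedFor.ext fun d f hf =>
      congrArg (fun t => t.1.1) ((h f hf).trans (h' f hf).symm)
  · exact (hD S hS).isSeparatedFor.ext fun d f hf =>
      congrArg (fun t => t.1.2) ((h f hf).trans (h' f hf).symm)
  · obtain ⟨a, ha, -⟩ := hA S hS (fun d f hf => (x f hf).1.1)
      fun _ _ _ g g' f f' hf hf' e => congrArg (fun t => t.1.1) (hx g g' hf hf' e)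
    obtain ⟨b, hb, -⟩ := hD S hS (fun d f hf => (x f hf).1.2)
      fun _ _ _ g g' f f' hf hf' e => congrArg (fun t => t.1.2) (hx g g' hf hf' e)
    refine ⟨⟨(a, b), ?_⟩, fun d f hf => Subtype.ext (Prod.ext (ha f hf) (hb f hf))⟩
    refine (hB S hS).isSeparatedFor.ext fun d f hf => ?_
    change B.map f.op (p.app _ a) = B.map f.op (q.app _ b)
    rw [← NatTrans.naturality_apply, ← NatTrans.naturality_apply, ha f hf, hb f hf, (x f hf).2]

theorem isSheaf_sliceExp (p : A ⟶ B) (q : D ⟶ B) (hD : Presieve.IsSheaf J D)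
    (hB : Presieve.IsSheaf J B) : Presieve.IsSheaf J (sliceExp p q) := by
  intro c S hS
  rw [← Presieve.isSeparatedFor_and_exists_isAmalgamation_iff_isSheafFor]
  refine ⟨fun x t t' h h' => ?_, fun x hx => ?_⟩
  · refine FunAt.sigma_ext ((hB S hS).isSeparatedFor.ext fun d f hf =>
      congrArg Sigma.fst ((h f hf).trans (h' f hf).symm)) fun d φ a hs ht => ?_
    refine (hD _ (J.pullback_stable φ.unop hS)).isSeparatedFor.ext fun e g hg => ?_
    have e1 := FunAt.congr_sigma ((h _ hg).trans (h' _ hg).symm) (𝟙 _) (A.map g.op a)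
      (by
        change p.app _ _ = B.map (𝟙 _) (B.map (φ ≫ g.op) t.1)
        rw [NatTrans.naturality_apply, hs, Functor.map_comp_apply, Functor.map_id_apply])
      (by
        change p.app _ _ = B.map (𝟙 _) (B.map (φ ≫ g.op) t'.1)
        rw [NatTrans.naturality_apply, ht, Functor.map_comp_apply, Functor.map_id_apply])
    change t.2.toFun ((φ ≫ g.op) ≫ 𝟙 _) _ _ = t'.2.toFun ((φ ≫ g.op) ≫ 𝟙 _) _ _ at e1
    rw [t.2.map_toFun, t'.2.map_toFun]
    simpa only [Category.comp_id] using e1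
  · obtain ⟨b, hb, -⟩ := hB S hS (fun d f hf => (x f hf).1)
      fun _ _ _ g g' f f' hf hf' e => congrArg Sigma.fst (hx g g' hf hf' e)
    have hx' := (Presieve.compatible_iff_sieveCompatible x).1 hx
    have hp : ∀ ⦃d : Cᵒᵖ⦄ (φ : op c ⟶ d) (a : A.obj d), p.app d a = B.map φ b →
        ∀ ⦃e : C⦄ (g : e ⟶ d.unop) (hg : S (g ≫ φ.unop)),
          p.app _ (A.map g.op a) = B.map (𝟙 _) (x _ hg).1 := by
      intro d φ a ha e g hg
      rw [NatTrans.naturality_apply, ha, Functor.map_id_apply]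
      exact (Functor.map_comp_apply B φ g.op b).symm.trans (hb _ hg)
    let fam : ∀ ⦃d : Cᵒᵖ⦄ (φ : op c ⟶ d) (a : A.obj d), p.app d a = B.map φ b →
        Presieve.FamilyOfElements D (S.pullback φ.unop).arrows :=
      fun d φ a ha e g hg => (x (g ≫ φ.unop) hg).2.toFun (𝟙 _) (A.map g.op a) (hp φ a ha g hg)
    have hfam : ∀ ⦃d : Cᵒᵖ⦄ (φ : op c ⟶ d) (a : A.obj d) (ha : p.app d a = B.map φ b),
        (fam φ a ha).Compatible := by
      intro d φ a ha
      rw [Presieve.compatible_iff_sieveCompatible]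
      intro e e' g k hg
      have h1 := hx' (g ≫ φ.unop) k hg
      have h2 : ∀ (hg' : S ((k ≫ g) ≫ φ.unop)), x _ hg' = (sliceExp p q).map k.op (x _ hg) := by
        intro hg'
        rw [← h1]
        congr 1
        simp only [Category.assoc]
      have h3 : p.app _ (A.map (k ≫ g).op a) = B.map (𝟙 _) (B.map k.op (x _ hg).1) := by
        rw [op_comp, Functor.map_comp_apply, NatTrans.naturality_apply, hp φ a ha g hg,
          Functor.map_id_apply, Functor.map_id_apply]
      refine (FunAt.congr_sigma (h2 _) (𝟙 _) _ _ h3).trans ?_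
      refine Eq.trans ?_ ((x _ hg).2.map_toFun (𝟙 _) k.op (A.map g.op a) _).symm
      exact FunAt.toFun_congr (x _ hg).2 (φ := k.op ≫ 𝟙 _) (ψ := 𝟙 _ ≫ k.op)
        ((Category.comp_id _).trans (Category.id_comp _).symm)
        (Functor.map_comp_apply A g.op k.op a) _ _
    let val : ∀ ⦃d : Cᵒᵖ⦄ (φ : op c ⟶ d) (a : A.obj d), p.app d a = B.map φ b → D.obj d :=
      fun d φ a ha => (hD _ (J.pullback_stable φ.unop hS)).amalgamate _ (hfam φ a ha)
    have hval : ∀ ⦃d : Cᵒᵖ⦄ (φ : op c ⟶ d) (a : A.obj d) (ha : p.app d a = B.map φ b),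
        (fam φ a ha).IsAmalgamation (val φ a ha) := fun d φ a ha =>
      (hD _ (J.pullback_stable φ.unop hS)).isAmalgamation (hfam φ a ha)
    refine ⟨⟨b, ⟨val, fun d φ a ha => ?_, fun d e φ ψ a ha => ?_⟩⟩, fun d f hf => ?_⟩
    · refine (hB _ (J.pullback_stable φ.unop hS)).isSeparatedFor.ext fun e g hg => ?_
      rw [← NatTrans.naturality_apply, hval φ a ha g hg]
      refine ((x _ hg).2.base_toFun _ _ _).trans ?_
      rw [← hp φ a ha g hg, NatTrans.naturality_apply, ha]
    · refine (hD _ (J.pullback_stable (φ ≫ ψ).unop hS)).isSeparatedFor.ext fun e' g hg => ?_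
      have ha' : p.app e (A.map ψ a) = B.map (φ ≫ ψ) b := by
        rw [NatTrans.naturality_apply, ha, Functor.map_comp_apply]
      rw [hval (φ ≫ ψ) (A.map ψ a) ha' g hg, ← Functor.map_comp_apply]
      have hg' : S ((g ≫ ψ.unop) ≫ φ.unop) := by simpa using hg
      refine (hval φ a ha (g ≫ ψ.unop) hg').trans ?_
      have h2 : x _ hg' = x _ hg := by congr 1; simp
      refine (FunAt.congr_sigma h2 (𝟙 _) _ _ ((hp φ a ha _ hg').trans (by rw [h2]))).trans ?_
      exact FunAt.toFun_congr (x _ hg).2 rfl (Functor.map_comp_apply A ψ g.op a) _ _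
    · refine FunAt.sigma_ext (hb f hf) fun e φ a hs ht => ?_
      have hg : S (𝟙 _ ≫ (f.op ≫ φ).unop) := by
        simpa using S.downward_closed hf φ.unop
      have h0 : p.app e a = B.map (f.op ≫ φ) b := by
        rw [Functor.map_comp_apply]; exact hs
      have h1 := hval (f.op ≫ φ) a h0 (𝟙 _) hg
      have h2 : x _ hg = (sliceExp p q).map φ (x f hf) := by
        refine Eq.trans ?_ (hx' f φ.unop hf)
        congr 1
        simp
      have h3 : p.app e a = B.map (𝟙 _) (B.map φ (x f hf).1) := by
        rw [Functor.map_id_apply]; exact ht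
      refine Eq.trans ?_ (h1.trans ?_)
      · rw [op_id, Functor.map_id_apply]; rfl
      · refine (FunAt.congr_sigma h2 (𝟙 _) (A.map (𝟙 _) a) _
          (by rw [Functor.map_id_apply]; exact h3)).trans ?_
        exact FunAt.toFun_congr (x f hf).2 (φ := φ ≫ 𝟙 _) (Category.comp_id _)
          (Functor.map_id_apply A _ a) _ _

/-- A subpresheaf of a sheaf whose membership can be tested locally is a sheaf. -/
theorem isSheaf_sub (G : Subfunctor A) (hA : Presieve.IsSheaf J A)
    (hG : ∀ ⦃c : C⦄ (S : Sieve c) (_ : S ∈ J c) (a : A.obj (op c)),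
      (∀ ⦃d : C⦄ (f : d ⟶ c), S f → A.map f.op a ∈ G.obj (op d)) → a ∈ G.obj (op c)) :
    Presieve.IsSheaf J G.toFunctor :=
  (Subfunctor.isSheaf_iff G hA).2 fun _ s hs => hG _ hs s fun _ _ hf => hf

end Slice

/-! ### The universes of retracts and of types with recursion -/

section Universes

open Limits Arity

variable {E U : Topos.{u}}

/-- The constant type `y_𝐍` in a context `U`: the projection `U × y_𝐍 ⟶ U`. -/
noncomputable abbrev natOver (U : Topos.{u}) : FunctorToTypes.prod U.obj yN.{u}.obj ⟶ U.obj :=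
  FunctorToTypes.prod.fst

/-- The type `X + 1` depending on `X : U`: as `E ⟶ U` is the family of all `X`, and `U ⟶ U` is the
family with all fibres `1`, it is the coproduct `E ⨿ U ⟶ U` of these two in the slice over `U`. -/
noncomputable abbrev plusOne (τ : E ⟶ U) : (E ⨿ U).obj ⟶ U.obj :=
  (coprod.desc τ (𝟙 U)).hom

/-- For `r : y_𝐍 → X + 1` and `s : X + 1 → y_𝐍`, the equation `r ∘ s = id`. -/
def IsRetraction (τ : E ⟶ U) {c : Arityᵒᵖ} {x x' : U.obj.obj c}
    (r : FunAt (natOver U) (plusOne τ) x) (s : FunAt (plusOne τ) (natOver U) x')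
    (hx : x = x') : Prop :=
  ∀ ⦃d : Arityᵒᵖ⦄ (φ : c ⟶ d) (y : (E ⨿ U).obj.obj d) (hy : (plusOne τ).app d y = U.obj.map φ x),
    r.toFun φ (s.toFun φ y (hx ▸ hy)) ((s.base_toFun φ y (hx ▸ hy)).trans (by rw [hx])) = y

/-- The universe `(X : U) × (r : y_𝐍 → X + 1) × (s : X + 1 → y_𝐍) × (r ∘ s = id)`, as a
presheaf. -/
noncomputable def retractSub (τ : E ⟶ U) :
    Subfunctor (fiberProd (sliceExpBase (natOver U) (plusOne τ))
      (sliceExpBase (plusOne τ) (natOver U))) where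
  obj _ := { t | IsRetraction τ t.1.1.2 t.1.2.2 t.2 }
  map χ _ ht _ φ y hy := ht (χ ≫ φ) y (hy.trans (Functor.map_comp_apply U.obj _ _ _).symm)

/-- The type `(g : X) × (h : y_𝐍 → X → X)` depending on `X : U`. -/
noncomputable abbrev RecData (τ : E ⟶ U) : Arityᵒᵖ ⥤ Type u :=
  fiberProd τ.hom (sliceExpBase (fiberProdBase (natOver U) τ.hom) τ.hom)

/-- The projection from `RecData` to the parameter `X : U`. -/
noncomputable abbrev recDataBase (τ : E ⟶ U) : RecData τ ⟶ U.obj :=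
  fiberProdBase τ.hom (sliceExpBase (fiberProdBase (natOver U) τ.hom) τ.hom)

/-- The value of a function `f : y_𝐍 → X` at an `n : y_𝐍` of a later stage. -/
def FunAt.val {τ : E ⟶ U} {c : Arityᵒᵖ} {x : U.obj.obj c} (f : FunAt (natOver U) τ.hom x)
    {d : Arityᵒᵖ} (φ : c ⟶ d) (n : yN.{u}.obj.obj d) : E.obj.obj d :=
  f.toFun φ (U.obj.map φ x, n) rfl

/-- The value of a function `h : y_𝐍 → X → X` at `n : y_𝐍` and `e : X` of a later stage. -/
def FunAt.val₂ {τ : E ⟶ U} {c : Arityᵒᵖ} {x : U.obj.obj c}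
    (h : FunAt (fiberProdBase (natOver U) τ.hom) τ.hom x)
    {d : Arityᵒᵖ} (φ : c ⟶ d) (n : yN.{u}.obj.obj d) (e : E.obj.obj d)
    (he : τ.hom.app d e = U.obj.map φ x) : E.obj.obj d :=
  h.toFun φ ⟨((U.obj.map φ x, n), e), he.symm⟩ rfl

/-- The type `comp(f, g, h)`: the equations `f 0 = g` and `f (n + 1) = h n (f n)` for all
`n : y_𝐍`. -/
def IsRecursor {τ : E ⟶ U} {c : Arityᵒᵖ} {x x' : U.obj.obj c}
    (f : FunAt (natOver U) τ.hom x) (g : E.obj.obj c)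
    (h : FunAt (fiberProdBase (natOver U) τ.hom) τ.hom x') (hx : x = x') : Prop :=
  f.val (𝟙 c) (yzero c) = g ∧
    ∀ ⦃d : Arityᵒᵖ⦄ (φ : c ⟶ d) (n : yN.{u}.obj.obj d),
      f.val φ (ysucc.hom.app d n) =
        h.val₂ φ n (f.val φ n) ((f.base_toFun φ _ rfl).trans (by rw [hx]))

/-- The universe
`(X : U) × ((g : X) → (h : y_𝐍 → X → X) → (f : y_𝐍 → X) × comp(f, g, h))`, as a presheaf: the
elements `Ψ` of the function type from `(g, h)` to `f` such that `comp(Ψ(g, h), g, h)` holds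
for all `g` and `h`. -/
noncomputable def recSub (τ : E ⟶ U) :
    Subfunctor (sliceExp (recDataBase τ) (sliceExpBase (natOver U) τ.hom)) where
  obj c := { t | ∀ ⦃d : Arityᵒᵖ⦄ (φ : c ⟶ d) (γ : (RecData τ).obj d)
    (hγ : (recDataBase τ).app d γ = U.obj.map φ t.1),
    IsRecursor (t.2.toFun φ γ hγ).2 γ.1.1 γ.1.2.2
      ((t.2.base_toFun φ γ hγ).trans (hγ.symm.trans γ.2)) }
  map χ _ ht _ φ γ hγ := ht (χ ≫ φ) γ (hγ.trans (Functor.map_comp_apply U.obj _ _ _).symm)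

theorem IsRetraction.of_local {τ : E ⟶ U} {c : Arity} (S : Sieve c) (hS : S ∈ finTopology c)
    {x x' : U.obj.obj (op c)} {r : FunAt (natOver U) (plusOne τ) x}
    {s : FunAt (plusOne τ) (natOver U) x'} {hx : x = x'}
    (h : ∀ ⦃d : Arity⦄ (f : d ⟶ c), S f → IsRetraction τ (r.restrict f.op rfl)
      (s.restrict f.op rfl) (congrArg _ hx)) : IsRetraction τ r s hx := by
  subst hx
  intro d φ y hy
  have hT := (isSheaf_iff_isSheaf_of_type _ _).1 (E ⨿ U).property
  refine (hT _ (finTopology.pullback_stable φ.unop hS)).isSeparatedFor.ext fun e g hg => ?_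
  have hy' : (plusOne τ).app _ ((E ⨿ U).obj.map g.op y) = U.obj.map (φ ≫ g.op) x := by
    rw [NatTrans.naturality_apply, hy, Functor.map_comp_apply]
  have h1 := h (g ≫ φ.unop) hg (𝟙 _) ((E ⨿ U).obj.map g.op y)
    (by rw [Functor.map_id_apply]; exact hy')
  rw [r.map_toFun]
  refine Eq.trans ?_ h1
  refine FunAt.toFun_congr r (φ := φ ≫ g.op) (ψ := (φ ≫ g.op) ≫ 𝟙 _) (Category.comp_id _).symm
    ?_ _ _
  refine (s.map_toFun φ g.op y hy).trans ?_
  exact FunAt.toFun_congr s (Category.comp_id _).symm rfl _ _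

theorem IsRecursor.of_local {τ : E ⟶ U} {c : Arity} (S : Sieve c) (hS : S ∈ finTopology c)
    {x x' : U.obj.obj (op c)} {f : FunAt (natOver U) τ.hom x} {g : E.obj.obj (op c)}
    {h : FunAt (fiberProdBase (natOver U) τ.hom) τ.hom x'} {hx : x = x'}
    (H : ∀ ⦃d : Arity⦄ (k : d ⟶ c), S k → IsRecursor (f.restrict k.op rfl)
      (E.obj.map k.op g) (h.restrict k.op rfl) (congrArg _ hx)) : IsRecursor f g h hx := by
  subst hx
  have hE := (isSheaf_iff_isSheaf_of_type _ _).1 E.property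
  constructor
  · refine (hE _ hS).isSeparatedFor.ext fun d k hk => ?_
    refine Eq.trans ?_ (H k hk).1
    refine (f.map_toFun _ _ _ _).trans ?_
    refine FunAt.toFun_congr f (ψ := k.op ≫ 𝟙 _) ?_ (Prod.ext ?_ (map_yzero k.op)) _ _
    · rw [Category.comp_id, Category.id_comp]
    · change U.obj.map k.op (U.obj.map (𝟙 _) x) = U.obj.map (𝟙 _) (U.obj.map k.op x)
      rw [Functor.map_id_apply, Functor.map_id_apply]
  · intro d φ n
    refine (hE _ (finTopology.pullback_stable φ.unop hS)).isSeparatedFor.ext fun e k hk => ?_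
    have h1 := (H (k ≫ φ.unop) hk).2 (𝟙 _) (yN.obj.map k.op n)
    have hU : U.obj.map k.op (U.obj.map φ x) =
        U.obj.map (𝟙 _) (U.obj.map (k ≫ φ.unop).op x) := by
      rw [Functor.map_id_apply]
      exact (Functor.map_comp_apply U.obj φ k.op x).symm
    refine Eq.trans ?_ (h1.trans ?_)
    · refine (f.map_toFun _ _ _ _).trans ?_
      refine FunAt.toFun_congr f (ψ := (φ ≫ k.op) ≫ 𝟙 _) (Category.comp_id _).symm
        (Prod.ext hU ?_) _ _
      exact (NatTrans.naturality_apply ysucc.hom k.op n).symm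
    · refine Eq.trans ?_ (h.map_toFun _ _ _ _).symm
      refine FunAt.toFun_congr h (φ := (φ ≫ k.op) ≫ 𝟙 _) (Category.comp_id _)
        ?_ _ _
      refine Subtype.ext (Prod.ext (Prod.ext hU.symm rfl) ?_)
      refine Eq.trans ?_ (f.map_toFun _ _ _ _).symm
      refine FunAt.toFun_congr f (φ := (φ ≫ k.op) ≫ 𝟙 _) (Category.comp_id _) ?_ _ _
      exact Prod.ext hU.symm rfl

theorem IsRecursor.congr {τ : E ⟶ U} {c : Arityᵒᵖ} {s t : Σ x : U.obj.obj c,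
    FunAt (natOver U) τ.hom x} (h : s = t) {g : E.obj.obj c} {x' : U.obj.obj c}
    {k : FunAt (fiberProdBase (natOver U) τ.hom) τ.hom x'} {hs : s.1 = x'} {ht : t.1 = x'}
    (H : IsRecursor s.2 g k hs) : IsRecursor t.2 g k ht := by
  subst h; exact H

/-- The universe of types `X : U` together with a retraction `y_𝐍 → X + 1`, as an object of
the topos. -/
noncomputable def retractUniverse (τ : E ⟶ U) : Topos.{u} :=
  ⟨(retractSub τ).toFunctor, (isSheaf_iff_isSheaf_of_type _ _).2 <| isSheaf_sub _
    (isSheaf_fiberProd _ _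
      (isSheaf_sliceExp _ _ ((isSheaf_iff_isSheaf_of_type _ _).1 (E ⨿ U).property)
        ((isSheaf_iff_isSheaf_of_type _ _).1 U.property))
      (isSheaf_sliceExp _ _ (isSheaf_prod ((isSheaf_iff_isSheaf_of_type _ _).1 U.property)
        ((isSheaf_iff_isSheaf_of_type _ _).1 yN.property))
        ((isSheaf_iff_isSheaf_of_type _ _).1 U.property))
      ((isSheaf_iff_isSheaf_of_type _ _).1 U.property))
    fun _ S hS t h => IsRetraction.of_local (hx := t.2) S hS fun _ f hf => h f hf⟩

/-- The universe of types `X : U` together with a `y_𝐍`-recursion operation, as an object of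
the topos. -/
noncomputable def recUniverse (τ : E ⟶ U) : Topos.{u} :=
  ⟨(recSub τ).toFunctor, (isSheaf_iff_isSheaf_of_type _ _).2 <| isSheaf_sub _
    (isSheaf_sliceExp _ _
      (isSheaf_sliceExp _ _ ((isSheaf_iff_isSheaf_of_type _ _).1 E.property)
        ((isSheaf_iff_isSheaf_of_type _ _).1 U.property))
      ((isSheaf_iff_isSheaf_of_type _ _).1 U.property))
    fun c S hS t h d φ γ hγ => IsRecursor.of_local _ (finTopology.pullback_stable φ.unop hS)
      fun e k hk => by
        have hγ' : (recDataBase τ).app (op e) ((RecData τ).map k.op γ) =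
            U.obj.map (𝟙 _) (U.obj.map (k ≫ φ.unop).op t.1) := by
          rw [NatTrans.naturality_apply, hγ, Functor.map_id_apply]
          exact (Functor.map_comp_apply U.obj φ k.op t.1).symm
        refine IsRecursor.congr
          (t := (sliceExp (natOver U) τ.hom).map k.op (t.2.toFun φ γ hγ)) ?_
          (h (k ≫ φ.unop) hk (𝟙 _) ((RecData τ).map k.op γ) hγ')
        refine Eq.trans ?_ (t.2.map_toFun φ k.op γ hγ).symm
        exact FunAt.toFun_congr t.2 (φ := (φ ≫ k.op) ≫ 𝟙 _) (Category.comp_id _) rfl _ _⟩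

/-- The projection sending a type with a retraction to its underlying type. -/
noncomputable def retractUniverseBase (τ : E ⟶ U) : retractUniverse τ ⟶ U :=
  ObjectProperty.homMk ((retractSub τ).ι ≫
    fiberProdBase (sliceExpBase (natOver U) (plusOne τ)) (sliceExpBase (plusOne τ) (natOver U)))

/-- The projection sending a type with recursion to its underlying type. -/
noncomputable def recUniverseBase (τ : E ⟶ U) : recUniverse τ ⟶ U :=
  ObjectProperty.homMk ((recSub τ).ι ≫
    sliceExpBase (recDataBase τ) (sliceExpBase (natOver U) τ.hom))

end Universes

/-! The sections of `yN` over `a` are exactly the computable functions from the points of `a` to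
`ℕ`. A covering sieve contains every point, so a section is determined by its values
(`eval_injective`). A section is primitive recursive along a finite cover. The cover combines into
one primitive recursive surjection, and searching for a preimage shows that the section is
computable (`computable_eval`). Conversely, a computable function becomes primitive recursive along
an enumeration of the arguments together with sufficient step bounds, and this enumeration is itself
a cover (`exists_eval_eq`).

Computable functions are closed under primitive recursion. A natural step function is determined by
its value on one generic triple of parameter, index and previous value, so `yN` admits recursion
into itself with parameters (`exists_natRec`). This passes to any retract `X` of `yN`: recurse on
codes and decode (`RetractAt.exists_recursor`).

The hypothesis makes only `X + 1` a retract. But a recursion problem comes with `g : X`, and sending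
the extra element to `g` turns `X` itself into a retract (`IsRetraction.retractAt`). This retraction
depends on `g`; the recursor does not, because it is unique: two solutions agree on numerals by
induction, and a subobject of `yN` is separated by points (`RetractAt.recursor_unique`). Uniqueness
also makes recursors chosen separately at each stage natural, so they assemble into a morphism. -/

namespace Arity

/-! ### Points, covers and computability -/

/-- The point `q` of `a`, as a morphism `𝟏 ⟶ a`. -/
def point {a : Arity} (q : a.Pt) : one ⟶ a := ⟨fun _ => q, Primrec.const q⟩

theorem point_comp {a b : Arity} (q : a.Pt) (f : a ⟶ b) : point q ≫ f = point (f.1 q) := rfl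

/-- A covering sieve of `a` contains every point of `a`. -/
theorem point_mem_of_cover {a : Arity} {S : Sieve a} (hS : S ∈ finTopology a) (q : a.Pt) :
    S (point q) := by
  obtain ⟨T, -, hTS, hs⟩ := hS
  obtain ⟨t, ht, x, rfl⟩ := hs q
  exact S.downward_closed (hTS t ht) (point x)

/-- The finitely many maps of a covering family can be combined into a single one, along which
a function that is primitive recursive on each map of the family is primitive recursive. -/
theorem exists_single_cover {a : Arity} (F : a.Pt → ℕ) {T : Set (Σ b : Arity, b ⟶ a)}
    (hT : T.Finite) (hF : ∀ t ∈ T, Primrec (F ∘ t.2.1)) :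
    ∃ h : ℕ → a.Pt, Primrec h ∧ Primrec (F ∘ h) ∧
      ∀ t ∈ T, ∀ x : t.1.Pt, ∃ n, h n = t.2.1 x := by
  induction T, hT using Set.Finite.induction_on with
  | empty => exact ⟨fun _ => default, Primrec.const _, Primrec.const (F default), by simp⟩
  | @insert t T _ _ ih =>
    obtain ⟨h, h1, h2, h3⟩ := ih fun s hs => hF s (Set.mem_insert_of_mem _ hs)
    let D : ℕ → t.1.Pt := fun n => (Encodable.decode (α := t.1.Pt) n).getD default
    have hD : Primrec D := Primrec.option_getD.comp Primrec.decode (Primrec.const _)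
    have hft := hF t (Set.mem_insert _ _)
    -- The lowest bit of `n` selects the new map or the combined old ones; the remaining bits are
    -- the index.
    refine ⟨fun n => cond n.bodd (t.2.1 (D n.div2)) (h n.div2),
      Primrec.cond Primrec.nat_bodd (t.2.2.comp (hD.comp Primrec.nat_div2))
        (h1.comp Primrec.nat_div2), ?_, ?_⟩
    · refine (Primrec.cond Primrec.nat_bodd (hft.comp (hD.comp Primrec.nat_div2))
        (h2.comp Primrec.nat_div2)).of_eq fun n => ?_
      cases hn : n.bodd <;> simp [hn]
    · intro s hs x
      rcases hs with rfl | hs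
      · refine ⟨Nat.bit true (Encodable.encode x), ?_⟩
        simp [D]
      · obtain ⟨n, hn⟩ := h3 s hs x
        exact ⟨Nat.bit false n, by simpa using hn⟩

/-- A function that becomes computable along a computable surjection is computable. -/
theorem computable_of_comp_surjective {α : Type*} [Primcodable α] {F : α → ℕ} {h : ℕ → α}
    (hh : Computable h) (hs : Function.Surjective h) (hF : Computable (F ∘ h)) : Computable F := by
  classical
  have hp : Computable₂ fun (q : α) (n : ℕ) => decide (h n = q) :=
    (Primrec.eq (α := α)).decide.to_comp.comp (hh.comp Computable.snd) Computable.fst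
  -- Unbounded search for a preimage: it terminates by surjectivity but need not be primitive
  -- recursive.
  have h1 : Partrec fun q : α => Nat.rfind (fun n => (decide (h n = q) : Part Bool)) :=
    Partrec.rfind hp.partrec₂
  have h2 : Partrec fun q : α =>
      (Nat.rfind (fun n => (decide (h n = q) : Part Bool))).map (F ∘ h) :=
    h1.map (hF.comp Computable.snd).to₂
  refine h2.of_eq fun q => ?_
  obtain ⟨m, hm⟩ := hs q
  obtain ⟨n, hn, -⟩ := Nat.rfind_min' (p := fun n => decide (h n = q)) (m := m) (by simpa using hm)
  have hq : h n = q := by simpa using Nat.rfind_spec hn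
  refine Part.eq_some_iff.2 ?_
  rw [Part.mem_map_iff]
  exact ⟨n, hn, congrArg F hq⟩

/-- A computable function becomes primitive recursive along a primitive recursive surjection. -/
theorem exists_primrec_cover {α : Type*} [Primcodable α] [Inhabited α] {F : α → ℕ}
    (hF : Computable F) :
    ∃ h : ℕ → α, Primrec h ∧ Function.Surjective h ∧ Primrec (F ∘ h) := by
  obtain ⟨c, hc⟩ := Nat.Partrec.Code.exists_code.1 hF
  let D : ℕ → ℕ × α := fun n => (Encodable.decode (α := ℕ × α) n).getD default
  have hD : Primrec D := Primrec.option_getD.comp Primrec.decode (Primrec.const _)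
  let V : ℕ → Option ℕ := fun n =>
    Nat.Partrec.Code.evaln (D n).1 c (Encodable.encode (D n).2)
  have hV : Primrec V := Nat.Partrec.Code.primrec_evaln.comp
    (((Primrec.fst.comp hD).pair (Primrec.const c)).pair
      (Primrec.encode.comp (Primrec.snd.comp hD)))
  have hval : ∀ q : α, Nat.Partrec.Code.eval c (Encodable.encode q) = Part.some (F q) := by
    intro q
    rw [hc]
    simp
  have hsound : ∀ n v, V n = some v → v = F (D n).2 := by
    intro n v hv
    have := Nat.Partrec.Code.evaln_sound (Option.mem_def.2 hv)
    rw [hval] at this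
    exact Part.mem_some_iff.1 this
  -- Here `n` codes a step bound and an argument. The argument is returned only if the computation
  -- halts within the bound, so that its value can be read off from `V n`; otherwise `default` is
  -- returned, whose value is a constant.
  refine ⟨fun n => cond (V n).isSome (D n).2 default,
    Primrec.cond (Primrec.option_isSome.comp hV) (Primrec.snd.comp hD) (Primrec.const _),
    fun q => ?_, ?_⟩
  · obtain ⟨k, hk⟩ := Nat.Partrec.Code.evaln_complete.1
      ((hval q).symm ▸ Part.mem_some (F q) : F q ∈ Nat.Partrec.Code.eval c (Encodable.encode q))
    refine ⟨Encodable.encode (k, q), ?_⟩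
    have h1 : D (Encodable.encode (k, q)) = (k, q) := by simp [D]
    have h2 : V (Encodable.encode (k, q)) = some (F q) := by
      simp only [V, h1]
      exact hk
    change cond (V _).isSome (D _).2 default = q
    rw [h2, h1]
    rfl
  · refine (Primrec.option_getD.comp hV (Primrec.const (F default))).of_eq fun n => ?_
    cases hv : V n with
    | none => simp [hv]
    | some v => simp [hv, hsound n v hv]

/-! ### Sections of `yN` as computable functions on points -/

/-- The element of `y_𝐍` given by a primitive recursive function. -/
noncomputable def yhom {a : Arity} (f : a ⟶ nat) : yN.{u}.obj.obj (op a) :=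
  (toSheafify finTopology (uliftYoneda.{u}.obj nat)).app (op a) (ULift.up f)

theorem map_yhom {a b : Arity} (g : b ⟶ a) (f : a ⟶ nat) :
    yN.{u}.obj.map g.op (yhom f) = yhom (g ≫ f) :=
  (NatTrans.naturality_apply (toSheafify finTopology (uliftYoneda.{u}.obj nat)) g.op _).symm

theorem ysucc_yhom {a : Arity} (f : a ⟶ nat) :
    ysucc.{u}.hom.app (op a) (yhom f) = yhom (f ≫ succHom) := by
  have h := toSheafify_naturality finTopology (uliftYoneda.{u}.map succHom)
  have h' := NatTrans.congr_app h (op a)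
  exact (ConcreteCategory.congr_hom (C := Type u) h' (ULift.up f : ULift.{u} (a ⟶ nat))).symm

theorem isSheaf_yN : Presieve.IsSheaf finTopology yN.{u}.obj :=
  (isSheaf_iff_isSheaf_of_type _ _).1 yN.property

/-- The presheaf of all functions from points to natural numbers. -/
def ptFun : Arityᵒᵖ ⥤ Type u where
  obj a := ULift.{u} (a.unop.Pt → ℕ)
  map f := ↾fun F => ULift.up (F.down ∘ f.unop.1)

/-- Every covering sieve contains all points, so an amalgamation can be read off, and is determined,
pointwise. -/
theorem isSheaf_ptFun : Presieve.IsSheaf finTopology ptFun.{u} := by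
  intro a S hS
  rw [← Presieve.isSeparatedFor_and_exists_isAmalgamation_iff_isSheafFor]
  refine ⟨fun x t t' h h' => ULift.ext _ _ (funext fun q => ?_), fun x hx => ?_⟩
  · have h1 := (h _ (point_mem_of_cover hS q)).trans (h' _ (point_mem_of_cover hS q)).symm
    exact congrArg (fun F : ULift.{u} (one.Pt → ℕ) => F.down default) h1
  · refine ⟨ULift.up fun q => (x _ (point_mem_of_cover hS q)).down default, fun b f hf =>
      ULift.ext _ _ (funext fun q => ?_)⟩
    have h1 := hx (𝟙 _) (point q) (point_mem_of_cover hS (f.1 q)) hf (point_comp q f)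
    exact congrArg (fun F : ULift.{u} (one.Pt → ℕ) => F.down default) h1

/-- A morphism into `𝐍`, as a function on points. -/
def repToPtFun : uliftYoneda.{u}.obj nat ⟶ ptFun.{u} where
  app a := ↾fun f => ULift.up f.down.1

/-- An element of `y_𝐍`, as a function on points. -/
noncomputable def yNToPtFun : yN.{u}.obj ⟶ ptFun.{u} :=
  sheafifyLift finTopology repToPtFun ((isSheaf_iff_isSheaf_of_type _ _).2 isSheaf_ptFun)

/-- The function on points given by an element of `y_𝐍`. -/
noncomputable def eval {a : Arity} (n : yN.{u}.obj.obj (op a)) (q : a.Pt) : ℕ :=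
  (yNToPtFun.app (op a) n).down q

theorem eval_yhom {a : Arity} (f : a ⟶ nat) : eval (yhom.{u} f) = f.1 := by
  have h := NatTrans.congr_app (toSheafify_sheafifyLift finTopology repToPtFun.{u}
    ((isSheaf_iff_isSheaf_of_type _ _).2 isSheaf_ptFun)) (op a)
  exact congrArg ULift.down
    (ConcreteCategory.congr_hom (C := Type u) h (ULift.up f : ULift.{u} (a ⟶ nat)))

theorem eval_map {a b : Arity} (g : b ⟶ a) (n : yN.{u}.obj.obj (op a)) :
    eval (yN.{u}.obj.map g.op n) = eval n ∘ g.1 := by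
  have h := NatTrans.naturality_apply yNToPtFun g.op n
  exact congrArg (fun F : ULift.{u} (b.Pt → ℕ) => F.down) h

/-- Every element of `y_𝐍` is locally given by primitive recursive functions. -/
theorem exists_cover_yhom {a : Arity} (n : yN.{u}.obj.obj (op a)) :
    ∃ S ∈ finTopology a, ∀ ⦃b : Arity⦄ (g : b ⟶ a), S g →
      ∃ f : b ⟶ nat, yhom f = yN.{u}.obj.map g.op n := by
  -- `G` consists of the sections that are locally in the image of the unit. It is a subsheaf
  -- through which the unit factors, so by the universal property its inclusion has a section and
  -- `G` is everything.
  let G : Subfunctor yN.{u}.obj :=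
    (Subfunctor.range (toSheafify finTopology (uliftYoneda.{u}.obj nat))).sheafify finTopology
  have hG : Presheaf.IsSheaf finTopology G.toFunctor :=
    (isSheaf_iff_isSheaf_of_type _ _).2 (Subfunctor.sheafify_isSheaf _ isSheaf_yN)
  let i : uliftYoneda.{u}.obj nat ⟶ G.toFunctor :=
    Subfunctor.toRangeSheafify finTopology (toSheafify finTopology (uliftYoneda.{u}.obj nat))
  have hi : i ≫ G.ι = toSheafify finTopology (uliftYoneda.{u}.obj nat) := rfl
  have h : sheafifyLift finTopology i hG ≫ G.ι = 𝟙 _ := by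
    refine sheafify_hom_ext finTopology _ _ yN.{u}.property ?_
    refine (Category.assoc _ _ _).symm.trans ?_
    rw [toSheafify_sheafifyLift, hi]
    exact (Category.comp_id _).symm
  have h1 : n ∈ G.obj (op a) := by
    have h2 := ConcreteCategory.congr_hom (C := Type u) (NatTrans.congr_app h (op a)) n
    have h3 : G.ι.app (op a) ((sheafifyLift finTopology i hG).app (op a) n) = n := h2
    exact h3 ▸ ((sheafifyLift finTopology i hG).app (op a) n).2
  refine ⟨_, h1, ?_⟩
  rintro b g ⟨f, hf⟩
  exact ⟨f.down, hf⟩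

theorem eval_yzero {a : Arity} (q : a.Pt) : eval (yzero.{u} (op a)) q = 0 :=
  congrFun (eval_yhom (zeroHom a)) q

/-- On a common refinement both sections come from morphisms of the site, which are determined by
their values; separatedness then gives equality. -/
theorem eval_injective {a : Arity} : Function.Injective (eval.{u} (a := a)) := by
  intro n m h
  obtain ⟨S, hS, hn⟩ := exists_cover_yhom n
  obtain ⟨S', hS', hm⟩ := exists_cover_yhom m
  refine (isSheaf_yN _ (finTopology.intersection_covering hS hS')).isSeparatedFor.ext
    fun b g hg => ?_
  obtain ⟨f, hf⟩ := hn g hg.1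
  obtain ⟨f', hf'⟩ := hm g hg.2
  have h1 : f.1 = f'.1 := by
    rw [← eval_yhom.{u} f, ← eval_yhom.{u} f', hf, hf', eval_map, eval_map, h]
  rw [← hf, ← hf', Subtype.ext h1]

theorem eval_ysucc {a : Arity} (n : yN.{u}.obj.obj (op a)) (q : a.Pt) :
    eval (ysucc.{u}.hom.app (op a) n) q = eval n q + 1 := by
  -- The point `q` lies in the covering sieve, so after restriction to it `n` is an honest morphism.
  obtain ⟨S, hS, hn⟩ := exists_cover_yhom n
  obtain ⟨f, hf⟩ := hn _ (point_mem_of_cover hS q)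
  have h1 := congrFun (eval_map (point q) (ysucc.{u}.hom.app (op a) n)) ()
  have h2 := congrFun (eval_map (point q) n) (default : one.Pt)
  rw [← hf, eval_yhom] at h2
  rw [← NatTrans.naturality_apply, ← hf, ysucc_yhom, eval_yhom] at h1
  exact h1.symm.trans (congrArg Nat.succ h2)

theorem computable_eval {a : Arity} (n : yN.{u}.obj.obj (op a)) : Computable (eval n) := by
  obtain ⟨S, ⟨T, hT, hTS, hs⟩, hn⟩ := exists_cover_yhom n
  obtain ⟨h, h1, h2, h3⟩ := exists_single_cover (eval n) hT fun t ht => by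
    obtain ⟨f, hf⟩ := hn t.2 (hTS t ht)
    rw [← eval_map, ← hf, eval_yhom]
    exact f.2
  refine computable_of_comp_surjective h1.to_comp (fun q => ?_) h2.to_comp
  obtain ⟨t, ht, x, rfl⟩ := hs q
  exact h3 t ht x

/-- Every computable function on points is given by an element of `y_𝐍`. -/
theorem exists_eval_eq {a : Arity} {F : a.Pt → ℕ} (hF : Computable F) :
    ∃ n : yN.{u}.obj.obj (op a), eval n = F := by
  obtain ⟨h, h1, h2, h3⟩ := exists_primrec_cover hF
  let k : nat ⟶ a := ⟨h, h1⟩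
  -- The single surjection `k` is a cover, and `F` is primitive recursive along everything that
  -- factors through it.
  have hS : IsFinCover (Sieve.generate (Presieve.singleton k)) :=
    ⟨{⟨nat, k⟩}, Set.finite_singleton _,
      by rintro _ rfl; exact Sieve.le_generate _ _ _ ⟨⟩, fun y => ⟨⟨nat, k⟩, rfl, h2 y⟩⟩
  have hprim : ∀ ⦃b : Arity⦄ (g : b ⟶ a), Sieve.generate (Presieve.singleton k) g →
      Primrec (F ∘ g.1) := by
    rintro b _ ⟨_, l, _, ⟨⟩, rfl⟩
    exact h3.comp l.2
  obtain ⟨n, hn, -⟩ := isSheaf_yN.{u} _ hS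
    (fun b g hg => yhom ⟨F ∘ g.1, hprim g hg⟩) (by
      intro b b' c g g' f f' hf hf' e
      rw [map_yhom, map_yhom]
      congr 1
      refine Subtype.ext ?_
      have e1 : f.1 ∘ g.1 = f'.1 ∘ g'.1 := congrArg Subtype.val e
      change F ∘ f.1 ∘ g.1 = F ∘ f'.1 ∘ g'.1
      rw [e1])
  refine ⟨n, funext fun q => ?_⟩
  have h4 := hn (point q) (point_mem_of_cover (S := Sieve.generate _) hS q)
  have h5 := congrFun (eval_map (point q) n) (default : one.Pt)
  rw [h4, eval_yhom] at h5
  exact h5.symm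

/-- Over a point every section becomes a standard numeral, so naturality reduces statements about
sections to numerals at stage `one`. -/
theorem map_point {a : Arity} (n : yN.{u}.obj.obj (op a)) (q : a.Pt) :
    yN.{u}.obj.map (point q).op n = yhom (point (a := nat) (eval n q)) := by
  apply eval_injective
  rw [eval_map, eval_yhom]
  rfl

theorem yhom_point_succ (k : ℕ) : yhom.{u} (point (a := nat) (k + 1 : ℕ)) =
    ysucc.{u}.hom.app (op one) (yhom (point (a := nat) k)) :=
  (ysucc_yhom (point (a := nat) k)).symm

/-! ### Recursion inside `yN` -/

/-- Recursion from `y_𝐍` to `y_𝐍` with parameters at a stage `a`. -/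
theorem exists_natRec {a : Arity} (z : yN.{u}.obj.obj (op a))
    (step : ∀ ⦃b : Arity⦄, (b ⟶ a) → yN.{u}.obj.obj (op b) → yN.{u}.obj.obj (op b) →
      yN.{u}.obj.obj (op b))
    (hstep : ∀ ⦃b c : Arity⦄ (f : b ⟶ a) (g : c ⟶ b) (n m : yN.{u}.obj.obj (op b)),
      yN.{u}.obj.map g.op (step f n m) =
        step (g ≫ f) (yN.{u}.obj.map g.op n) (yN.{u}.obj.map g.op m)) :
    ∃ F : ∀ ⦃b : Arity⦄, (b ⟶ a) → yN.{u}.obj.obj (op b) → yN.{u}.obj.obj (op b),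
      (∀ ⦃b c : Arity⦄ (f : b ⟶ a) (g : c ⟶ b) (n : yN.{u}.obj.obj (op b)),
        yN.{u}.obj.map g.op (F f n) = F (g ≫ f) (yN.{u}.obj.map g.op n)) ∧
      (∀ ⦃b : Arity⦄ (f : b ⟶ a), F f (yzero (op b)) = yN.{u}.obj.map f.op z) ∧
      ∀ ⦃b : Arity⦄ (f : b ⟶ a) (n : yN.{u}.obj.obj (op b)),
        F f (ysucc.{u}.hom.app (op b) n) = step f n (F f n) := by
  let D : ℕ → a.Pt × ℕ × ℕ := fun n =>
    (Encodable.decode (α := a.Pt × ℕ × ℕ) n).getD default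
  have hD : Primrec D := Primrec.option_getD.comp Primrec.decode (Primrec.const _)
  let π : nat ⟶ a := ⟨fun n => (D n).1, Primrec.fst.comp hD⟩
  let k : nat ⟶ nat := ⟨fun n => (D n).2.1, Primrec.fst.comp (Primrec.snd.comp hD)⟩
  let l : nat ⟶ nat := ⟨fun n => (D n).2.2, Primrec.snd.comp (Primrec.snd.comp hD)⟩
  -- The step function at the generic triple: `nat` enumerates `a.Pt × ℕ × ℕ`, and `π`, `yhom k`,
  -- `yhom l` are its coordinates.
  let H : ℕ → ℕ := eval (step π (yhom k) (yhom l))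
  have hH : Computable H := computable_eval _
  have key : ∀ ⦃b : Arity⦄ (f : b ⟶ a) (n m : yN.{u}.obj.obj (op b)) (q : b.Pt),
      eval (step f n m) q = eval (step (point (f.1 q)) (yhom (point (a := nat) (eval n q)))
        (yhom (point (a := nat) (eval m q)))) (default : one.Pt) := by
    intro b f n m q
    rw [← map_point, ← map_point, ← point_comp, ← hstep, eval_map]
    rfl
  have key' : ∀ ⦃b : Arity⦄ (f : b ⟶ a) (n m : yN.{u}.obj.obj (op b)) (q : b.Pt),
      eval (step f n m) q = H (Encodable.encode (f.1 q, eval n q, eval m q)) := by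
    intro b f n m q
    have hDe : D (Encodable.encode (f.1 q, eval n q, eval m q)) =
        (f.1 q, eval n q, eval m q) := by simp [D]
    have h1 := key π (yhom k) (yhom l) (Encodable.encode (f.1 q, eval n q, eval m q) : ℕ)
    -- By `key` both sides are values of `step` at stage `one`; decoding the code of the triple
    -- shows that the arguments coincide.
    rw [key]
    refine Eq.trans ?_ h1.symm
    have e1 : π.1 (Encodable.encode (f.1 q, eval n q, eval m q) : ℕ) = f.1 q :=
      congrArg (fun t => t.1) hDe
    have e2 : eval (yhom.{u} k) (Encodable.encode (f.1 q, eval n q, eval m q) : ℕ) =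
        eval n q := by
      rw [eval_yhom]
      exact congrArg (fun t => t.2.1) hDe
    have e3 : eval (yhom.{u} l) (Encodable.encode (f.1 q, eval n q, eval m q) : ℕ) =
        eval m q := by
      rw [eval_yhom]
      exact congrArg (fun t => t.2.2) hDe
    rw [e1, e2, e3]
  -- External recursion with step `H`; its computability is what lets it be a section of `yN` again.
  let R : a.Pt × ℕ → ℕ := fun t =>
    Nat.rec (motive := fun _ => ℕ) (eval z t.1) (fun i v => H (Encodable.encode (t.1, i, v))) t.2
  have hR : Computable R := Computable.nat_rec Computable.snd
    ((computable_eval z).comp Computable.fst)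
    ((hH.comp (Computable.encode.comp
      ((Computable.fst.comp Computable.fst).pair Computable.snd))).to₂)
  have hF : ∀ ⦃b : Arity⦄ (f : b ⟶ a) (n : yN.{u}.obj.obj (op b)),
      ∃ m : yN.{u}.obj.obj (op b), eval m = fun q => R (f.1 q, eval n q) := fun b f n =>
    exists_eval_eq (hR.comp (f.2.to_comp.pair (computable_eval n)))
  choose F hF using hF
  refine ⟨F, fun b c f g n => ?_, fun b f => ?_, fun b f n => ?_⟩
  · apply eval_injective
    rw [eval_map, hF, hF, eval_map]
    rfl
  · apply eval_injective
    rw [eval_map, hF]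
    funext q
    rw [eval_yzero]
    rfl
  · apply eval_injective
    funext q
    rw [key', hF, hF]
    dsimp only
    rw [eval_ysucc]

end Arity

section Universes

open Limits Arity

variable {E U : Topos.{u}} {τ : E ⟶ U}

/-! ### Collapsing `X + 1` onto an inhabited `X` -/

/-- The map sending `e : X` to the constant function `X → X` with value `e`. -/
def constEnd (τ : E ⟶ U) : E.obj ⟶ sliceExp τ.hom τ.hom where
  app c := ↾fun e => ⟨τ.hom.app c e,
    { toFun := fun _ φ _ _ => E.obj.map φ e
      base_toFun := fun _ φ _ _ => NatTrans.naturality_apply τ.hom φ e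
      map_toFun := fun _ _ φ ψ _ _ => (Functor.map_comp_apply E.obj φ ψ e).symm }⟩
  naturality _ _ χ := ConcreteCategory.hom_ext _ _ fun e =>
    FunAt.sigma_ext (NatTrans.naturality_apply τ.hom χ e) fun _ φ _ _ _ =>
      (Functor.map_comp_apply E.obj χ φ e).symm

/-- The identity functions of all types `X : U`. -/
def idEnd (τ : E ⟶ U) : U.obj ⟶ sliceExp τ.hom τ.hom where
  app _ := ↾fun x => ⟨x,
    { toFun := fun _ _ a _ => a
      base_toFun := fun _ _ _ ha => ha
      map_toFun := fun _ _ _ _ _ _ => rfl }⟩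
  naturality _ _ _ := ConcreteCategory.hom_ext _ _ fun _ =>
    FunAt.sigma_ext rfl fun _ _ _ _ _ => rfl

/-- The object of types `X : U` with a function `X → X`. -/
def endSheaf (τ : E ⟶ U) : Topos.{u} :=
  ⟨sliceExp τ.hom τ.hom, (isSheaf_iff_isSheaf_of_type _ _).2 <| isSheaf_sliceExp _ _
    ((isSheaf_iff_isSheaf_of_type _ _).1 E.property)
    ((isSheaf_iff_isSheaf_of_type _ _).1 U.property)⟩

/-- The map `X + 1 → (X → X)` that is constant on each element of `X` and sends the other element
to the identity. -/
noncomputable def plusOneEnd (τ : E ⟶ U) : E ⨿ U ⟶ endSheaf τ :=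
  -- The coproduct of sheaves does not split into cases stage by stage. The case distinction must
  -- use its universal property, hence the curried target.
  coprod.desc (ObjectProperty.homMk (constEnd τ)) (ObjectProperty.homMk (idEnd τ))

/-- Checked on the two summands; it ensures that the endofunction attached to `y` acts on the fibre
over which `y` lies. -/
theorem plusOneEnd_fst {c : Arityᵒᵖ} (y : (E ⨿ U).obj.obj c) :
    ((plusOneEnd τ).hom.app c y).1 = (plusOne τ).app c y := by
  let b : endSheaf τ ⟶ U := ObjectProperty.homMk (sliceExpBase τ.hom τ.hom)
  have h : plusOneEnd τ ≫ b = coprod.desc τ (𝟙 U) := by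
    refine coprod.hom_ext ?_ ?_
    · rw [plusOneEnd, coprod.inl_desc_assoc, coprod.inl_desc]
      rfl
    · rw [plusOneEnd, coprod.inr_desc_assoc, coprod.inr_desc]
      rfl
  exact ConcreteCategory.congr_hom (C := Type u)
    (NatTrans.congr_app (congrArg (fun f => f.hom) h) c) y

/-- The inclusion of `X` in `X + 1`. -/
noncomputable def inlAt (U : Topos.{u}) {c : Arityᵒᵖ} (e : E.obj.obj c) : (E ⨿ U).obj.obj c :=
  (coprod.inl : E ⟶ E ⨿ U).hom.app c e

theorem map_inlAt {c d : Arityᵒᵖ} (φ : c ⟶ d) (e : E.obj.obj c) :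
    (E ⨿ U).obj.map φ (inlAt U e) = inlAt U (E.obj.map φ e) :=
  (NatTrans.naturality_apply (coprod.inl : E ⟶ E ⨿ U).hom φ e).symm

theorem plusOne_inlAt {c : Arityᵒᵖ} (e : E.obj.obj c) :
    (plusOne τ).app c (inlAt U e) = τ.hom.app c e :=
  ConcreteCategory.congr_hom (C := Type u)
    (NatTrans.congr_app (congrArg (fun f => f.hom) (coprod.inl_desc τ (𝟙 U))) c) e

theorem plusOneEnd_inlAt {c : Arityᵒᵖ} (e : E.obj.obj c) :
    (plusOneEnd τ).hom.app c (inlAt U e) = (constEnd τ).app c e :=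
  ConcreteCategory.congr_hom (C := Type u)
    (NatTrans.congr_app (congrArg (fun f => f.hom) (coprod.inl_desc
      (ObjectProperty.homMk (constEnd τ) : E ⟶ endSheaf τ) (ObjectProperty.homMk (idEnd τ)))) c) e

/-- The function `X + 1 → X` that is the identity on `X` and sends the other element to `e`. -/
noncomputable def collapse (τ : E ⟶ U) {c : Arityᵒᵖ} (y : (E ⨿ U).obj.obj c) (e : E.obj.obj c)
    (h : τ.hom.app c e = (plusOne τ).app c y) : E.obj.obj c :=
  ((plusOneEnd τ).hom.app c y).2.toFun (𝟙 c) e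
    (by rw [h, Functor.map_id_apply, plusOneEnd_fst])

theorem collapse_base {c : Arityᵒᵖ} (y : (E ⨿ U).obj.obj c) (e : E.obj.obj c)
    (h : τ.hom.app c e = (plusOne τ).app c y) :
    τ.hom.app c (collapse τ y e h) = (plusOne τ).app c y := by
  refine (FunAt.base_toFun _ _ _ _).trans ?_
  rw [Functor.map_id_apply, plusOneEnd_fst]

theorem map_collapse {c d : Arityᵒᵖ} (φ : c ⟶ d) (y : (E ⨿ U).obj.obj c) (e : E.obj.obj c)
    (h : τ.hom.app c e = (plusOne τ).app c y)
    (h' : τ.hom.app d (E.obj.map φ e) = (plusOne τ).app d ((E ⨿ U).obj.map φ y)) :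
    E.obj.map φ (collapse τ y e h) = collapse τ ((E ⨿ U).obj.map φ y) (E.obj.map φ e) h' := by
  have h1 : (plusOneEnd τ).hom.app d ((E ⨿ U).obj.map φ y) =
      (sliceExp τ.hom τ.hom).map φ ((plusOneEnd τ).hom.app c y) :=
    NatTrans.naturality_apply (plusOneEnd τ).hom φ y
  refine (FunAt.map_toFun _ _ _ _ _).trans ?_
  refine Eq.trans ?_ (FunAt.congr_sigma h1 (𝟙 d) (E.obj.map φ e) _ (by
    rw [← h1, h', Functor.map_id_apply, plusOneEnd_fst])).symm
  exact FunAt.toFun_congr _ (φ := 𝟙 c ≫ φ) (ψ := φ ≫ 𝟙 d)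
    ((Category.id_comp _).trans (Category.comp_id _).symm) rfl _ _

theorem collapse_inlAt {c : Arityᵒᵖ} (e' e : E.obj.obj c)
    (h : τ.hom.app c e = (plusOne τ).app c (inlAt U e')) :
    collapse τ (inlAt U e') e h = e' := by
  refine (FunAt.congr_sigma (plusOneEnd_inlAt e') (𝟙 c) e _ ?_).trans
    (Functor.map_id_apply E.obj c e')
  rw [h, plusOne_inlAt, Functor.map_id_apply]
  rfl

/-! ### Retracts of `yN` and their recursors -/

/-- At stage `c`, the structure of a retract of `y_𝐍` on the fibre of `τ` over `x`. -/
structure RetractAt (τ : E ⟶ U) {c : Arityᵒᵖ} (x : U.obj.obj c) where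
  /-- The inclusion into `y_𝐍`. -/
  enc : ∀ ⦃d : Arityᵒᵖ⦄ (φ : c ⟶ d) (e : E.obj.obj d), τ.hom.app d e = U.obj.map φ x →
    yN.{u}.obj.obj d
  /-- The retraction from `y_𝐍`. -/
  dec : ∀ ⦃d : Arityᵒᵖ⦄ (_ : c ⟶ d), yN.{u}.obj.obj d → E.obj.obj d
  dec_base : ∀ ⦃d : Arityᵒᵖ⦄ (φ : c ⟶ d) (n : yN.{u}.obj.obj d),
    τ.hom.app d (dec φ n) = U.obj.map φ x
  map_enc : ∀ ⦃d d' : Arityᵒᵖ⦄ (φ : c ⟶ d) (ψ : d ⟶ d') (e : E.obj.obj d)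
    (he : τ.hom.app d e = U.obj.map φ x)
    (he' : τ.hom.app d' (E.obj.map ψ e) = U.obj.map (φ ≫ ψ) x),
    yN.{u}.obj.map ψ (enc φ e he) = enc (φ ≫ ψ) (E.obj.map ψ e) he'
  map_dec : ∀ ⦃d d' : Arityᵒᵖ⦄ (φ : c ⟶ d) (ψ : d ⟶ d') (n : yN.{u}.obj.obj d),
    E.obj.map ψ (dec φ n) = dec (φ ≫ ψ) (yN.{u}.obj.map ψ n)
  dec_enc : ∀ ⦃d : Arityᵒᵖ⦄ (φ : c ⟶ d) (e : E.obj.obj d) (he : τ.hom.app d e = U.obj.map φ x),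
    dec φ (enc φ e he) = e

/-- If `X + 1` is a retract of `y_𝐍` and `X` has an element, then `X` is a retract of `y_𝐍`. -/
noncomputable def IsRetraction.retractAt {c : Arityᵒᵖ} {x x' : U.obj.obj c}
    {r : FunAt (natOver U) (plusOne τ) x} {s : FunAt (plusOne τ) (natOver U) x'}
    {hx : x = x'} (h : IsRetraction τ r s hx) (g : E.obj.obj c) (hg : τ.hom.app c g = x) :
    RetractAt τ x where
  enc _ φ e he := (s.toFun φ (inlAt U e) ((plusOne_inlAt e).trans (he.trans (by rw [hx])))).2
  -- Decode into `X + 1`, then replace the extra element by `g`.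
  dec _ φ n := collapse τ (r.toFun φ (U.obj.map φ x, n) rfl) (E.obj.map φ g)
    ((NatTrans.naturality_apply τ.hom φ g).trans ((congrArg _ hg).trans
      (r.base_toFun φ _ rfl).symm))
  dec_base _ φ _ := (collapse_base _ _ _).trans (r.base_toFun φ _ rfl)
  map_enc _ _ φ ψ e he he' := by
    refine (congrArg Prod.snd (s.map_toFun φ ψ (inlAt U e) _)).trans ?_
    exact congrArg Prod.snd (FunAt.toFun_congr s rfl (map_inlAt ψ e) _ _)
  map_dec d d' φ ψ n := by
    have hU : U.obj.map ψ (U.obj.map φ x) = U.obj.map (φ ≫ ψ) x :=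
      (Functor.map_comp_apply U.obj φ ψ x).symm
    have h1 : (E ⨿ U).obj.map ψ (r.toFun φ (U.obj.map φ x, n) rfl) =
        r.toFun (φ ≫ ψ) (U.obj.map (φ ≫ ψ) x, yN.obj.map ψ n) rfl := by
      refine (r.map_toFun φ ψ _ _).trans (FunAt.toFun_congr r rfl ?_ _ _)
      exact Prod.ext hU rfl
    have h2 : E.obj.map ψ (E.obj.map φ g) = E.obj.map (φ ≫ ψ) g :=
      (Functor.map_comp_apply E.obj φ ψ g).symm
    have h3 : τ.hom.app d' (E.obj.map ψ (E.obj.map φ g)) =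
        (plusOne τ).app d' ((E ⨿ U).obj.map ψ (r.toFun φ (U.obj.map φ x, n) rfl)) := by
      rw [h1, h2, NatTrans.naturality_apply, hg]
      exact (r.base_toFun (φ ≫ ψ) _ rfl).symm
    refine (map_collapse ψ _ _ _ h3).trans ?_
    congr 1
  dec_enc d φ e he := by
    have hy : (plusOne τ).app d (inlAt U e) = U.obj.map φ x := (plusOne_inlAt e).trans he
    have hy' : (plusOne τ).app d (inlAt U e) = U.obj.map φ x' := hy.trans (by rw [hx])
    have h1 : (U.obj.map φ x, (s.toFun φ (inlAt U e) hy').2) = s.toFun φ (inlAt U e) hy' :=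
      Prod.ext (by rw [hx]; exact (s.base_toFun φ (inlAt U e) hy').symm) rfl
    have h2 : r.toFun φ (U.obj.map φ x, (s.toFun φ (inlAt U e) hy').2) rfl = inlAt U e :=
      (FunAt.toFun_congr r rfl h1 _ _).trans (h φ (inlAt U e) hy)
    have h3 : τ.hom.app d (E.obj.map φ g) = (plusOne τ).app d (inlAt U e) := by
      rw [NatTrans.naturality_apply, hg, hy]
    refine Eq.trans ?_ (collapse_inlAt e (E.obj.map φ g) h3)
    congr 1

theorem FunAt.val_base {c : Arityᵒᵖ} {x : U.obj.obj c} (f : FunAt (natOver U) τ.hom x)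
    {d : Arityᵒᵖ} (φ : c ⟶ d) (n : yN.{u}.obj.obj d) :
    τ.hom.app d (f.val φ n) = U.obj.map φ x :=
  f.base_toFun φ _ rfl

theorem FunAt.map_val {c : Arityᵒᵖ} {x : U.obj.obj c} (f : FunAt (natOver U) τ.hom x)
    {d d' : Arityᵒᵖ} (φ : c ⟶ d) (ψ : d ⟶ d') (n : yN.{u}.obj.obj d) :
    E.obj.map ψ (f.val φ n) = f.val (φ ≫ ψ) (yN.obj.map ψ n) := by
  have hU : U.obj.map ψ (U.obj.map φ x) = U.obj.map (φ ≫ ψ) x :=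
    (Functor.map_comp_apply U.obj φ ψ x).symm
  refine (f.map_toFun φ ψ _ _).trans (FunAt.toFun_congr f rfl ?_ _ _)
  exact Prod.ext hU rfl

theorem FunAt.val₂_base {c : Arityᵒᵖ} {x : U.obj.obj c}
    (h : FunAt (fiberProdBase (natOver U) τ.hom) τ.hom x)
    {d : Arityᵒᵖ} (φ : c ⟶ d) (n : yN.{u}.obj.obj d) (e : E.obj.obj d)
    (he : τ.hom.app d e = U.obj.map φ x) :
    τ.hom.app d (h.val₂ φ n e he) = U.obj.map φ x :=
  h.base_toFun φ _ rfl

theorem FunAt.map_val₂ {c : Arityᵒᵖ} {x : U.obj.obj c}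
    (h : FunAt (fiberProdBase (natOver U) τ.hom) τ.hom x)
    {d d' : Arityᵒᵖ} (φ : c ⟶ d) (ψ : d ⟶ d') (n : yN.{u}.obj.obj d) (e : E.obj.obj d)
    (he : τ.hom.app d e = U.obj.map φ x)
    (he' : τ.hom.app d' (E.obj.map ψ e) = U.obj.map (φ ≫ ψ) x) :
    E.obj.map ψ (h.val₂ φ n e he) = h.val₂ (φ ≫ ψ) (yN.obj.map ψ n) (E.obj.map ψ e) he' := by
  have hU : U.obj.map ψ (U.obj.map φ x) = U.obj.map (φ ≫ ψ) x :=
    (Functor.map_comp_apply U.obj φ ψ x).symm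
  refine (h.map_toFun φ ψ _ _).trans (FunAt.toFun_congr h rfl ?_ _ _)
  exact Subtype.ext (Prod.ext (Prod.ext hU rfl) rfl)

theorem FunAt.ext_val {c : Arityᵒᵖ} {x : U.obj.obj c} {f f' : FunAt (natOver U) τ.hom x}
    (h : ∀ ⦃d : Arityᵒᵖ⦄ (φ : c ⟶ d) (n : yN.{u}.obj.obj d), f.val φ n = f'.val φ n) :
    f = f' := by
  ext d φ a ha
  obtain ⟨b, n⟩ := a
  obtain rfl : b = U.obj.map φ x := ha
  exact h φ n

/-- A retract of `y_𝐍` has at most one function satisfying given recursion equations. -/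
theorem RetractAt.recursor_unique {c : Arityᵒᵖ} {x x' : U.obj.obj c} (R : RetractAt τ x)
    {f f' : FunAt (natOver U) τ.hom x} {g : E.obj.obj c}
    {h : FunAt (fiberProdBase (natOver U) τ.hom) τ.hom x'} {hx : x = x'}
    (hf : IsRecursor f g h hx) (hf' : IsRecursor f' g h hx) : f = f' := by
  subst hx
  -- Only standard numerals occur at stage `one`, so ordinary induction suffices there.
  have key : ∀ (k : ℕ) (φ : c ⟶ op one), f.val φ (yhom (point (a := nat) k)) =
      f'.val φ (yhom (point (a := nat) k)) := by
    intro k φ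
    induction k with
    | zero =>
      have h1 := f.map_val (𝟙 c) φ (yzero c)
      have h2 := f'.map_val (𝟙 c) φ (yzero c)
      rw [hf.1, Category.id_comp, map_yzero] at h1
      rw [hf'.1, Category.id_comp, map_yzero] at h2
      exact h1.symm.trans h2
    | succ k ih =>
      rw [yhom_point_succ, hf.2, hf'.2]
      congr 1
  refine FunAt.ext_val fun d φ n => ?_
  -- Encoding moves the comparison into `yN`, where points separate sections; at each point `key`
  -- applies.
  have h1 : R.enc φ (f.val φ n) (f.val_base φ n) = R.enc φ (f'.val φ n) (f'.val_base φ n) := by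
    apply eval_injective
    funext q
    have h2 : yN.obj.map (point q).op (R.enc φ (f.val φ n) (f.val_base φ n)) =
        yN.obj.map (point q).op (R.enc φ (f'.val φ n) (f'.val_base φ n)) := by
      have e : E.obj.map (point q).op (f.val φ n) = E.obj.map (point q).op (f'.val φ n) := by
        rw [FunAt.map_val, FunAt.map_val, map_point, key]
      rw [R.map_enc φ _ _ _ (by rw [FunAt.map_val, FunAt.val_base]),
        R.map_enc φ _ _ _ (by rw [FunAt.map_val, FunAt.val_base])]
      congr 1
    have h3 := congrFun (congrArg eval h2) (default : one.Pt)
    rw [Arity.eval_map, Arity.eval_map] at h3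
    exact h3
  rw [← R.dec_enc φ (f.val φ n) (f.val_base φ n), h1, R.dec_enc]

/-- A retract of `y_𝐍` has `y_𝐍`-recursion. -/
theorem RetractAt.exists_recursor {c : Arityᵒᵖ} {x x' : U.obj.obj c} (R : RetractAt τ x)
    (g : E.obj.obj c) (hg : τ.hom.app c g = x)
    (h : FunAt (fiberProdBase (natOver U) τ.hom) τ.hom x') (hx : x = x') :
    ∃ f : FunAt (natOver U) τ.hom x, IsRecursor f g h hx := by
  subst hx
  have hg' : τ.hom.app c g = U.obj.map (𝟙 c) x := by rw [hg, Functor.map_id_apply]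
  -- Recursion on codes: start at the code of `g`; at each step decode, apply `h` and encode again.
  obtain ⟨F, hF, hF0, hFs⟩ := exists_natRec (a := c.unop) (R.enc (𝟙 c) g hg')
    (fun b k n m => R.enc k.op (h.val₂ k.op n (R.dec k.op m) (R.dec_base _ _))
      (h.val₂_base _ _ _ _)) (by
      intro b d k l n m
      have e1 : E.obj.map l.op (R.dec k.op m) = R.dec (l ≫ k).op (yN.obj.map l.op m) :=
        R.map_dec k.op l.op m
      have e2 : E.obj.map l.op (h.val₂ k.op n (R.dec k.op m) (R.dec_base _ _)) =
          h.val₂ (l ≫ k).op (yN.obj.map l.op n) (R.dec (l ≫ k).op (yN.obj.map l.op m))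
            (R.dec_base _ _) := by
        refine (h.map_val₂ k.op l.op n _ _ (by rw [e1]; exact R.dec_base _ _)).trans ?_
        congr 1
      refine (R.map_enc k.op l.op _ _ (by rw [e2]; exact h.val₂_base _ _ _ _)).trans ?_
      congr 1)
  let f : FunAt (natOver U) τ.hom x :=
    { toFun := fun d φ a _ => R.dec φ (F φ.unop a.2)
      base_toFun := fun d φ a _ => R.dec_base φ _
      map_toFun := fun d e φ ψ a _ =>
        (R.map_dec φ ψ _).trans (congrArg (R.dec (φ ≫ ψ)) (hF φ.unop ψ.unop a.2)) }
  refine ⟨f, ?_, fun d φ n => ?_⟩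
  · refine Eq.trans ?_ (R.dec_enc (𝟙 c) g hg')
    refine congrArg (R.dec (𝟙 c)) ((hF0 (𝟙 c.unop)).trans ?_)
    exact Functor.map_id_apply yN.obj c _
  · exact (congrArg (R.dec φ) (hFs φ.unop n)).trans (R.dec_enc φ _ _)

theorem IsRecursor.restrict {c d : Arityᵒᵖ} {x x' : U.obj.obj c}
    {f : FunAt (natOver U) τ.hom x} {g : E.obj.obj c}
    {h : FunAt (fiberProdBase (natOver U) τ.hom) τ.hom x'} {hx : x = x'}
    (H : IsRecursor f g h hx) (χ : c ⟶ d) :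
    IsRecursor (f.restrict χ rfl) (E.obj.map χ g) (h.restrict χ rfl) (congrArg _ hx) := by
  subst hx
  have hv : ∀ ⦃e : Arityᵒᵖ⦄ (φ : d ⟶ e) (n : yN.{u}.obj.obj e),
      (f.restrict χ rfl).val φ n = f.val (χ ≫ φ) n := by
    intro e φ n
    refine FunAt.toFun_congr f (φ := χ ≫ φ) rfl ?_ _ _
    exact Prod.ext (Functor.map_comp_apply U.obj χ φ x).symm rfl
  constructor
  · have h1 := f.map_val (𝟙 c) χ (yzero c)
    rw [H.1, Category.id_comp, map_yzero] at h1
    rw [hv, Category.comp_id, h1]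
  · intro e φ n
    rw [hv, H.2]
    have hU : U.obj.map (χ ≫ φ) x = U.obj.map φ (U.obj.map χ x) :=
      Functor.map_comp_apply U.obj χ φ x
    refine FunAt.toFun_congr h (φ := χ ≫ φ) rfl ?_ _ _
    exact Subtype.ext (Prod.ext (Prod.ext hU rfl) (hv φ n).symm)

/-! ### Assembling the recursors into a morphism -/

theorem exists_recursor_of_retract {c : Arityᵒᵖ} {t : (retractUniverse τ).obj.obj c}
    (γ : (RecData τ).obj c) (hγ : (recDataBase τ).app c γ = t.1.1.1.1) :
    ∃ f : FunAt (natOver U) τ.hom t.1.1.1.1, IsRecursor f γ.1.1 γ.1.2.2 (hγ.symm.trans γ.2) :=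
  RetractAt.exists_recursor (IsRetraction.retractAt (hx := t.1.2) t.2 γ.1.1 hγ) γ.1.1 hγ _ _

/-- Phrased for pairs of a base element and a function because the base points of the recursors
compared are only propositionally equal. -/
theorem recursor_unique_of_retract {c : Arityᵒᵖ} {t : (retractUniverse τ).obj.obj c}
    (γ : (RecData τ).obj c) (hγ : (recDataBase τ).app c γ = t.1.1.1.1)
    {s s' : Σ x : U.obj.obj c, FunAt (natOver U) τ.hom x} (hs : s.1 = γ.1.2.1)
    (hs' : s'.1 = γ.1.2.1) (H : IsRecursor s.2 γ.1.1 γ.1.2.2 hs)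
    (H' : IsRecursor s'.2 γ.1.1 γ.1.2.2 hs') : s = s' := by
  obtain ⟨x, f⟩ := s
  obtain ⟨x', f'⟩ := s'
  obtain rfl : x = t.1.1.1.1 := hs.trans (γ.2.symm.trans hγ)
  obtain rfl : x' = t.1.1.1.1 := hs'.trans (γ.2.symm.trans hγ)
  exact congrArg _
    (RetractAt.recursor_unique (IsRetraction.retractAt (hx := t.1.2) t.2 γ.1.1 hγ) H H')

/-- The recursion operation of a type with a retraction. -/
noncomputable def recursorAt {c : Arityᵒᵖ} (t : (retractUniverse τ).obj.obj c) :
    FunAt (recDataBase τ) (sliceExpBase (natOver U) τ.hom) t.1.1.1.1 where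
  toFun _ φ γ hγ := ⟨U.obj.map φ t.1.1.1.1,
    (exists_recursor_of_retract (t := (retractUniverse τ).obj.map φ t) γ hγ).choose⟩
  base_toFun _ _ _ _ := rfl
  map_toFun d e φ ψ γ hγ := by
    -- The restricted choice and the choice made at the later stage solve the same recursion
    -- problem, so uniqueness identifies them.
    have hγ' : (recDataBase τ).app e ((RecData τ).map ψ γ) = U.obj.map (φ ≫ ψ) t.1.1.1.1 := by
      rw [NatTrans.naturality_apply, hγ, Functor.map_comp_apply]
    have h1 := (exists_recursor_of_retract (t := (retractUniverse τ).obj.map φ t) γ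
      hγ).choose_spec.restrict ψ
    have h2 := (exists_recursor_of_retract (t := (retractUniverse τ).obj.map (φ ≫ ψ) t)
      ((RecData τ).map ψ γ) hγ').choose_spec
    exact recursor_unique_of_retract (t := (retractUniverse τ).obj.map (φ ≫ ψ) t)
      ((RecData τ).map ψ γ) hγ' _ _ h1 h2

theorem isRecursor_recursorAt {c d : Arityᵒᵖ} (t : (retractUniverse τ).obj.obj c) (φ : c ⟶ d)
    (γ : (RecData τ).obj d) (hγ : (recDataBase τ).app d γ = U.obj.map φ t.1.1.1.1) :
    IsRecursor ((recursorAt t).toFun φ γ hγ).2 γ.1.1 γ.1.2.2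
      (((recursorAt t).base_toFun φ γ hγ).trans (hγ.symm.trans γ.2)) :=
  (exists_recursor_of_retract (t := (retractUniverse τ).obj.map φ t) γ hγ).choose_spec

/-- The recursion operation of a type with a retraction, as an element of `recUniverse τ`. -/
noncomputable def retractToRecAt {c : Arityᵒᵖ} (t : (retractUniverse τ).obj.obj c) :
    (recUniverse τ).obj.obj c :=
  ⟨⟨t.1.1.1.1, recursorAt t⟩, fun _ φ γ hγ => isRecursor_recursorAt t φ γ hγ⟩

theorem map_retractToRecAt {c d : Arityᵒᵖ} (χ : c ⟶ d) (t : (retractUniverse τ).obj.obj c) :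
    retractToRecAt ((retractUniverse τ).obj.map χ t) =
      (recUniverse τ).obj.map χ (retractToRecAt t) := by
  refine Subtype.ext (FunAt.sigma_ext rfl fun e φ γ hs ht => ?_)
  exact recursor_unique_of_retract
    (t := (retractUniverse τ).obj.map φ ((retractUniverse τ).obj.map χ t)) γ hs _ _
    (isRecursor_recursorAt ((retractUniverse τ).obj.map χ t) φ γ hs)
    (isRecursor_recursorAt t (χ ≫ φ) γ (hs.trans (Functor.map_comp_apply U.obj χ φ _).symm))

/-- The map from types with a retraction to types with recursion. -/
noncomputable def retractToRec (τ : E ⟶ U) : retractUniverse τ ⟶ recUniverse τ :=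
  ObjectProperty.homMk
    { app _ := ↾fun t => retractToRecAt t
      naturality _ _ χ := ConcreteCategory.hom_ext _ _ fun t => map_retractToRecAt χ t }

end Universes

/-- For every family of types `τ : E ⟶ U` in the topos (in particular for the generic family of
a universe of small types), there is a map from the universe of types `X : U` with a retraction
`y_𝐍 → X + 1` to the universe of types `X : U` with `y_𝐍`-recursion, and this map preserves the
underlying type. -/
theorem mainTheorem6 (E U : Arity.Topos.{u}) (τ : E ⟶ U) :
    ∃ Φ : retractUniverse τ ⟶ recUniverse τ, Φ ≫ recUniverseBase τ = retractUniverseBase τ :=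
  -- The base element is carried along unchanged, so the triangle commutes definitionally.
  ⟨retractToRec τ, rfl⟩
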